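/- Let $\Theta=\{(p,q,r)\in[0,1]^3: p+q+r>0,\ p+q\le 1\}$. For $(p,q,r)\in\Theta$ let $\widehat{G}_{p,q,r}$ be the probabilistic cellular automaton on $\Omega=\{W,L,D\}^{\mathbb Z}$ which maps $\eta\in\Omega$ to a random configuration whose coordinates are independent, the coordinate at $x\in\mathbb Z$ being equal to $b$ with probability $\widehat\varphi(\eta(x),\eta(x+1),b)$, where $\widehat\varphi$ is symmetric in its first two arguments and, for $b=W$, $b=D$, $b=L$ respectively, \begin{align*} \widehat\varphi(W,W,\cdot)&: && p, && 0, && 1-p;\\ \widehat\varphi(W,L,\cdot)&: && p+(1-p-q)(1-r), && 0, && q+(1-p-q)r;\\ \widehat\varphi(L,L,\cdot)&: && p+(1-p-q)(1-r^2), && 0, && q+(1-p-q)r^2;\\ \widehat\varphi(W,D,\cdot)&: && p, && (1-p-q)(1-r), && q+(1-p-q)r;\\ \widehat\varphi(L,D,\cdot)&: && p+(1-p-q)(1-r), && (1-p-q)r(1-r), && q+(1-p-q)r^2;\\ \widehat\varphi(D,D,\cdot)&: && p, && (1-p-q)(1-r^2), && q+(1-p-q)r^2. \end{align*} A probability measure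 $\mu$ on $\Omega$ (with the $\sigma$-field generated by the cylinder sets) is called stationary if $\widehat{G}_{p,q,r}\mu=\mu$, i.e. applying one step of the automaton to a random configuration with law $\mu$ gives a random configuration with law $\mu$; translation-invariant if it is invariant under $\eta\mapsto(\eta(x+y))_{x\in\mathbb Z}$ for every $y\in\mathbb Z$; and reflection-invariant if it is invariant under $\eta\mapsto(\eta(-x))_{x\in\mathbb Z}$. There exist $\epsilon_1,\epsilon_2,\epsilon_3\in(0,1)$ such that the following holds for every $(p,q,r)\in\Theta$ with $p\le\epsilon_1$, $q\le\epsilon_2$, $r\le\epsilon_3$ that satisfies $$2(p+q)+6r^2+3r(p+2q)\ \ge\ 4r+(p+q)^2$$ and precisely one of the following four systems of constraints: (1) $p(1-p)\le q\{1-q-r(1-p-q)\}$; (2) $q\{1-q-r(1-p-q)\}<p(1-p)\le\{q+r(1-p-q)\}\{1-q-r(1-p-q)\}$ and $p-2q+pq+qr-3pr-2p^2+3q^2\le 0$; (3) $q\{1-q-r(1-p-q)\}<p(1-p)\le\{q+r(1-p-q)\}\{1-q-r(1-p-q)\}$, $p-2q+pq+qr-3pr-2p^2+3q^2>0$ and $p+4q+9pr+5qr+6r^2\ge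 4r+p^2+4q^2+5pq$; (4) $q+r(1-p-q)<p$ and $6q+10pr+4qr+p^2+6r^2\ge 4r+6pq+7q^2$. If $\mu$ is any translation-invariant and reflection-invariant stationary probability measure for $\widehat{G}_{p,q,r}$, then $\mu(\{\eta\in\Omega:\eta(x)=D\})=0$ for every $x\in\mathbb Z$. -/

import Mathlib

open MeasureTheory ProbabilityTheory

/-- The alphabet `{W, L, D}` (win, loss, draw) of the envelope automaton. -/
inductive GameState : Type
  | W : GameState
  | L : GameState
  | D : GameState
  deriving DecidableEq

namespace GameState

instance instFintype : Fintype GameState where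
  elems := {.W, .L, .D}
  complete := fun a => by cases a <;> simp

/-- The alphabet carries the discrete `σ`-algebra. -/
instance instMeasurableSpace : MeasurableSpace GameState := ⊤

instance instDiscreteMeasurableSpace : DiscreteMeasurableSpace GameState :=
  ⟨fun _ => trivial⟩

end GameState

/-- Bi-infinite configurations `η : ℤ → {W, L, D}`, with the `σ`-algebra generated by the cylinder
sets (the product `σ`-algebra). -/
abbrev Config : Type := ℤ → GameState

/-! ### Parameters and regime -/

/-- The parameter space: `(p, q, r) ∈ [0,1]³` with `p + q + r > 0` and `p + q ≤ 1`. -/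
def paramSpace : Set (ℝ × ℝ × ℝ) :=
  {t | t.1 ∈ Set.Icc 0 1 ∧ t.2.1 ∈ Set.Icc 0 1 ∧ t.2.2 ∈ Set.Icc 0 1 ∧
    0 < t.1 + t.2.1 + t.2.2 ∧ t.1 + t.2.1 ≤ 1}

/-- The inequality that is imposed throughout the regime. -/
def UniversalCondition (p q r : ℝ) : Prop :=
  4 * r + (p + q) ^ 2 ≤ 2 * (p + q) + 6 * r ^ 2 + 3 * r * (p + 2 * q)

/-- The four alternative systems of constraints on `(p, q, r)`. -/
def RegimeCondition (p q r : ℝ) : Fin 4 → Prop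
  | 0 => p * (1 - p) ≤ q * (1 - q - r * (1 - p - q))
  | 1 =>
      q * (1 - q - r * (1 - p - q)) < p * (1 - p) ∧
      p * (1 - p) ≤ (q + r * (1 - p - q)) * (1 - q - r * (1 - p - q)) ∧
      p - 2 * q + p * q + q * r - 3 * p * r - 2 * p ^ 2 + 3 * q ^ 2 ≤ 0
  | 2 =>
      q * (1 - q - r * (1 - p - q)) < p * (1 - p) ∧
      p * (1 - p) ≤ (q + r * (1 - p - q)) * (1 - q - r * (1 - p - q)) ∧
      0 < p - 2 * q + p * q + q * r - 3 * p * r - 2 * p ^ 2 + 3 * q ^ 2 ∧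
      4 * r + p ^ 2 + 4 * q ^ 2 + 5 * p * q ≤ p + 4 * q + 9 * p * r + 5 * q * r + 6 * r ^ 2
  | 3 =>
      q + r * (1 - p - q) < p ∧
      4 * r + 6 * p * q + 7 * q ^ 2 ≤ 6 * q + 10 * p * r + 4 * q * r + p ^ 2 + 6 * r ^ 2

/-! ### One-dimensional probabilistic cellular automata with neighbourhood `{0, 1}` -/

section PCA

variable {A : Type} [MeasurableSpace A]

/-- The law of the updated configuration, given the present configuration `η`: the cells are
updated independently, cell `x` with law `φ (η x) (η (x + 1))`. -/
noncomputable def pcaUpdateLaw (φ : A → A → PMF A) (η : ℤ → A) : Measure (ℤ → A) :=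
  Measure.infinitePi (fun x : ℤ => (φ (η x) (η (x + 1))).toMeasure)

theorem measurable_pcaUpdateLaw [Countable A] [DiscreteMeasurableSpace A]
    (φ : A → A → PMF A) : Measurable (pcaUpdateLaw φ) := by
  have : ∀ η, IsProbabilityMeasure (pcaUpdateLaw φ η) := fun η => by
    unfold pcaUpdateLaw; infer_instance
  refine Measurable.measure_of_isPiSystem_of_isProbabilityMeasure
    (S := squareCylinders (fun _ : ℤ => {s : Set A | MeasurableSet s}))
    generateFrom_squareCylinders.symm
    (isPiSystem_squareCylinders (fun _ => MeasurableSpace.isPiSystem_measurableSet)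
      (fun _ => MeasurableSet.univ)) ?_
  rintro _ ⟨s, t, ht, rfl⟩
  have ht' : ∀ i ∈ s, MeasurableSet (t i) := fun i _ => ht i (Set.mem_univ i)
  simp only [pcaUpdateLaw]
  simp_rw [Measure.infinitePi_pi _ ht']
  refine Finset.measurable_prod _ fun i _ => ?_
  have h2 : Measurable (fun c : A × A => (φ c.1 c.2).toMeasure (t i)) := measurable_of_countable _
  exact h2.comp (f := fun η : ℤ → A => (η i, η (i + 1))) (by fun_prop)

/-- The Markov kernel on configurations given by one step of the automaton whose stochastic update
matrix is `φ`. -/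
noncomputable def pcaKernel [Countable A] [DiscreteMeasurableSpace A]
    (φ : A → A → PMF A) : Kernel (ℤ → A) (ℤ → A) where
  toFun := pcaUpdateLaw φ
  measurable' := measurable_pcaUpdateLaw φ

end PCA

/-! ### The envelope automaton of the generalized percolation game -/

/-- The stochastic update matrix: `envelopeMatrix p q r a₀ a₁ b` is the probability that the
updated state is `b` when the two neighbouring states are `a₀` and `a₁`. -/
def envelopeMatrix (p q r : ℝ) : GameState → GameState → GameState → ℝ
  | .W, .W, .W => p
  | .W, .W, .D => 0
  | .W, .W, .L => 1 - p
  | .W, .L, .W | .L, .W, .W => p + (1 - p - q) * (1 - r)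
  | .W, .L, .D | .L, .W, .D => 0
  | .W, .L, .L | .L, .W, .L => q + (1 - p - q) * r
  | .L, .L, .W => p + (1 - p - q) * (1 - r ^ 2)
  | .L, .L, .D => 0
  | .L, .L, .L => q + (1 - p - q) * r ^ 2
  | .W, .D, .W | .D, .W, .W => p
  | .W, .D, .D | .D, .W, .D => (1 - p - q) * (1 - r)
  | .W, .D, .L | .D, .W, .L => (1 - p - q) * r + q
  | .L, .D, .W | .D, .L, .W => p + (1 - p - q) * (1 - r)
  | .L, .D, .D | .D, .L, .D => (1 - p - q) * r * (1 - r)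
  | .L, .D, .L | .D, .L, .L => q + (1 - p - q) * r ^ 2
  | .D, .D, .W => p
  | .D, .D, .D => (1 - p - q) * (1 - r ^ 2)
  | .D, .D, .L => q + (1 - p - q) * r ^ 2

theorem envelopeMatrix_nonneg {p q r : ℝ} (h : (p, q, r) ∈ paramSpace) (a₀ a₁ b : GameState) :
    0 ≤ envelopeMatrix p q r a₀ a₁ b := by
  obtain ⟨⟨hp, hp1⟩, ⟨hq, hq1⟩, ⟨hr, hr1⟩, -, hpq⟩ := h
  simp only at hp hp1 hq hq1 hr hr1 hpq
  have ho : 0 ≤ 1 - p - q := by linarith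
  have hr' : 0 ≤ 1 - r := by linarith
  have hr2 : 0 ≤ 1 - r ^ 2 := by nlinarith
  have hp' : 0 ≤ 1 - p := by linarith
  cases a₀ <;> cases a₁ <;> cases b <;> simp only [envelopeMatrix] <;> positivity

theorem sum_envelopeMatrix (p q r : ℝ) (a₀ a₁ : GameState) :
    ∑ b, envelopeMatrix p q r a₀ a₁ b = 1 := by
  have hu : (Finset.univ : Finset GameState) = {.W, .L, .D} := rfl
  cases a₀ <;> cases a₁ <;> simp [hu, envelopeMatrix] <;> ring

/-- The rows of the stochastic update matrix, as probability distributions on the alphabet. -/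
noncomputable def envelopeRule {p q r : ℝ} (h : (p, q, r) ∈ paramSpace) (a₀ a₁ : GameState) :
    PMF GameState :=
  PMF.ofFintype (fun b => ENNReal.ofReal (envelopeMatrix p q r a₀ a₁ b)) (by
    rw [← ENNReal.ofReal_sum_of_nonneg (fun b _ => envelopeMatrix_nonneg h a₀ a₁ b),
      sum_envelopeMatrix, ENNReal.ofReal_one])

/-- The envelope automaton with parameters `(p, q, r)`, as a Markov kernel on configurations. -/
noncomputable def envelopePCA {p q r : ℝ} (h : (p, q, r) ∈ paramSpace) : Kernel Config Config :=
  pcaKernel (envelopeRule h)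

/-! ### Symmetries of measures on configurations -/

/-- Translation by `y`: `(shift y η)(x) = η(x + y)`. -/
def Config.shift (y : ℤ) (η : Config) : Config := fun x => η (x + y)

/-- Reflection: `(reflect η)(x) = η(-x)`. -/
def Config.reflect (η : Config) : Config := fun x => η (-x)

/-- `ν` is invariant under all translations. -/
def TranslationInvariant (ν : Measure Config) : Prop :=
  ∀ (y : ℤ) (B : Set Config), MeasurableSet B → ν (Config.shift y '' B) = ν B

/-- `ν` is invariant under reflection. -/
def ReflectionInvariant (ν : Measure Config) : Prop :=
  ∀ B : Set Config, MeasurableSet B → ν (Config.reflect '' B) = ν B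

/-! The proof is a Lyapunov argument. Take a local observable `potential`, every term of which
contains a D. Under a stationary law its expected one-step increment integrates to zero, and by
translation invariance so does the gradient of `corrector`. Reflection invariance then gives
integral zero to `symmDrift`, a function of four consecutive letters. It vanishes on words without
D, because W and L alone never produce a D. If it is strictly negative on every word containing D,
such words are null (`measure_draw_eq_zero`).

Strict negativity is an expansion at the origin. The regime forces `r ≤ 17/10 * q + 2/7 * p ^ 2`
(`mem_driftRegion`), and on that region each drift is known up to `o(q + r + p ^ 2)` from its
coefficients at `1, p, q, r, p ^ 2`. Here `p` has half the weight of `q` and `r`, so `p ^ 2` is kept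
while `p * q` and `p * r` are negligible. The coefficients are integers, so the signs reduce to a
finite computation (`symmDriftJet_negative`). -/

open Filter Asymptotics Topology

/-! ### Truncated expansions at the origin. -/

/-- A polynomial `c + u * p + v * q + w * r + s * p ^ 2` with integer coefficients. -/
structure Jet : Type where
  c : ℤ
  u : ℤ
  v : ℤ
  w : ℤ
  s : ℤ
  deriving DecidableEq

namespace Jet

instance : Add Jet := ⟨fun j k => ⟨j.c + k.c, j.u + k.u, j.v + k.v, j.w + k.w, j.s + k.s⟩⟩

instance : Sub Jet := ⟨fun j k => ⟨j.c - k.c, j.u - k.u, j.v - k.v, j.w - k.w, j.s - k.s⟩⟩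

/-- Multiplication, truncated to the monomials `1, p, q, r, p ^ 2`. -/
instance : Mul Jet := ⟨fun j k =>
  ⟨j.c * k.c, j.c * k.u + j.u * k.c, j.c * k.v + j.v * k.c, j.c * k.w + j.w * k.c,
    j.c * k.s + j.u * k.u + j.s * k.c⟩⟩

/-- The part of a jet spanned by `q, r, p ^ 2`. -/
def tail (j : Jet) (t : ℝ × ℝ × ℝ) : ℝ := j.v * t.2.1 + j.w * t.2.2 + j.s * t.1 ^ 2

/-- The value of a jet at `t = (p, q, r)`. -/
def eval (j : Jet) (t : ℝ × ℝ × ℝ) : ℝ := j.c + j.u * t.1 + j.tail t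

/-- The constant jet. -/
def const (n : ℤ) : Jet := ⟨n, 0, 0, 0, 0⟩

end Jet

/-- The scale `q + r + p ^ 2` at `t = (p, q, r)`. -/
def driftScale (t : ℝ × ℝ × ℝ) : ℝ := t.2.1 + t.2.2 + t.1 ^ 2

/-- The part of the nonnegative octant where `r ≤ 17/10 * q + 2/7 * p ^ 2`. -/
def driftRegion : Set (ℝ × ℝ × ℝ) :=
  {t | 0 ≤ t.1 ∧ 0 ≤ t.2.1 ∧ 0 ≤ t.2.2 ∧ t.2.2 ≤ 17 / 10 * t.2.1 + 2 / 7 * t.1 ^ 2}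

/-- `F` agrees with the jet `j` up to an error `o(q + r + p ^ 2)` at the origin. -/
def HasJet (F : ℝ × ℝ × ℝ → ℝ) (j : Jet) : Prop :=
  (fun t => F t - j.eval t) =o[𝓝[driftRegion] 0] driftScale

theorem eventually_mem_driftRegion : ∀ᶠ t in 𝓝[driftRegion] 0, t ∈ driftRegion :=
  self_mem_nhdsWithin

theorem tendsto_nhdsWithin_driftRegion {F : ℝ × ℝ × ℝ → ℝ} (hF : Continuous F) :
    Tendsto F (𝓝[driftRegion] 0) (𝓝 (F 0)) :=
  hF.continuousAt.tendsto.mono_left nhdsWithin_le_nhds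

theorem continuous_driftScale : Continuous driftScale := by unfold driftScale; fun_prop

theorem driftScale_nonneg {t : ℝ × ℝ × ℝ} (ht : t ∈ driftRegion) : 0 ≤ driftScale t := by
  obtain ⟨-, hq, hr, -⟩ := ht
  unfold driftScale
  positivity

namespace Jet

theorem continuous_tail (j : Jet) : Continuous j.tail := by unfold tail; fun_prop

theorem continuous_eval (j : Jet) : Continuous j.eval := by
  unfold eval
  have := j.continuous_tail
  fun_prop

theorem tail_isBigO (j : Jet) : j.tail =O[𝓝[driftRegion] 0] driftScale := by
  refine IsBigO.of_bound (|(j.v : ℝ)| + |(j.w : ℝ)| + |(j.s : ℝ)|) ?_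
  filter_upwards [eventually_mem_driftRegion] with t ht
  rw [Real.norm_eq_abs, Real.norm_of_nonneg (driftScale_nonneg ht)]
  obtain ⟨-, hq, hr, -⟩ := ht
  have hp := sq_nonneg t.1
  have h1 : |(j.v : ℝ) * t.2.1| = |(j.v : ℝ)| * t.2.1 := by rw [abs_mul, abs_of_nonneg hq]
  have h2 : |(j.w : ℝ) * t.2.2| = |(j.w : ℝ)| * t.2.2 := by rw [abs_mul, abs_of_nonneg hr]
  have h3 : |(j.s : ℝ) * t.1 ^ 2| = |(j.s : ℝ)| * t.1 ^ 2 := by rw [abs_mul, abs_of_nonneg hp]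
  have h4 := abs_add_three ((j.v : ℝ) * t.2.1) (j.w * t.2.2) (j.s * t.1 ^ 2)
  rw [h1, h2, h3] at h4
  refine h4.trans ?_
  unfold driftScale
  nlinarith [mul_nonneg (abs_nonneg (j.v : ℝ)) hq, mul_nonneg (abs_nonneg (j.v : ℝ)) hr,
    mul_nonneg (abs_nonneg (j.v : ℝ)) hp, mul_nonneg (abs_nonneg (j.w : ℝ)) hq,
    mul_nonneg (abs_nonneg (j.w : ℝ)) hr, mul_nonneg (abs_nonneg (j.w : ℝ)) hp,
    mul_nonneg (abs_nonneg (j.s : ℝ)) hq, mul_nonneg (abs_nonneg (j.s : ℝ)) hr,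
    mul_nonneg (abs_nonneg (j.s : ℝ)) hp]

theorem mul_tail_isLittleO (j : Jet) {G : ℝ × ℝ × ℝ → ℝ} (hG : Continuous G) (h0 : G 0 = 0) :
    (fun t => G t * j.tail t) =o[𝓝[driftRegion] 0] driftScale := by
  have h1 : G =o[𝓝[driftRegion] 0] (fun _ => (1 : ℝ)) :=
    (isLittleO_one_iff ℝ).2 (h0 ▸ tendsto_nhdsWithin_driftRegion hG)
  simpa using h1.mul_isBigO j.tail_isBigO

/-- Every discarded term is a tail, of order `driftScale`, times a factor vanishing at the origin.
-/
theorem eval_mul_sub_isLittleO (j k : Jet) :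
    (fun t => j.eval t * k.eval t - (j * k).eval t) =o[𝓝[driftRegion] 0] driftScale := by
  have h1 := k.mul_tail_isLittleO (G := fun t => j.u * t.1 + j.tail t)
    (by have := j.continuous_tail; fun_prop) (by simp [tail])
  have h2 := j.mul_tail_isLittleO (G := fun t => k.u * t.1) (by fun_prop) (by simp)
  refine (h1.add h2).congr_left fun t => ?_
  change _ = _ - (Jet.mk _ _ _ _ _).eval t
  simp only [eval, tail]
  push_cast
  ring

end Jet

namespace HasJet

variable {F G : ℝ × ℝ × ℝ → ℝ} {j k : Jet}

theorem tendsto (hF : HasJet F j) : Tendsto F (𝓝[driftRegion] 0) (𝓝 j.c) := by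
  have h1 : Tendsto (fun t => F t - j.eval t) (𝓝[driftRegion] 0) (𝓝 0) := by
    refine IsLittleO.trans_tendsto hF ?_
    simpa [driftScale] using tendsto_nhdsWithin_driftRegion continuous_driftScale
  have h2 := h1.add (tendsto_nhdsWithin_driftRegion j.continuous_eval)
  simpa [Jet.eval, Jet.tail] using h2

theorem add (hF : HasJet F j) (hG : HasJet G k) : HasJet (fun t => F t + G t) (j + k) := by
  refine (IsLittleO.add hF hG).congr_left fun t => ?_
  change _ = _ - (Jet.mk _ _ _ _ _).eval t
  simp only [Jet.eval, Jet.tail]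
  push_cast
  ring

theorem sub (hF : HasJet F j) (hG : HasJet G k) : HasJet (fun t => F t - G t) (j - k) := by
  refine (IsLittleO.sub hF hG).congr_left fun t => ?_
  change _ = _ - (Jet.mk _ _ _ _ _).eval t
  simp only [Jet.eval, Jet.tail]
  push_cast
  ring

theorem mul (hF : HasJet F j) (hG : HasJet G k) : HasJet (fun t => F t * G t) (j * k) := by
  have h1 := IsLittleO.mul_isBigO hF (hG.tendsto.isBigO_one ℝ)
  have h2 := ((tendsto_nhdsWithin_driftRegion j.continuous_eval).isBigO_one ℝ).mul_isLittleO hG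
  simp only [mul_one, one_mul] at h1 h2
  refine ((h1.add h2).add (j.eval_mul_sub_isLittleO k)).congr_left fun t => ?_
  ring

theorem of_eq (h : ∀ t, F t = j.eval t) : HasJet F j := by
  have : (fun t => F t - j.eval t) = fun _ => 0 := funext fun t => by rw [h t, sub_self]
  rw [HasJet, this]
  exact isLittleO_zero _ _

theorem const (n : ℤ) : HasJet (fun _ => (n : ℝ)) (Jet.const n) :=
  of_eq fun t => by simp [Jet.eval, Jet.tail, Jet.const]

theorem fst : HasJet (fun t => t.1) ⟨0, 1, 0, 0, 0⟩ :=
  of_eq fun t => by simp [Jet.eval, Jet.tail]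

theorem snd : HasJet (fun t => t.2.1) ⟨0, 0, 1, 0, 0⟩ :=
  of_eq fun t => by simp [Jet.eval, Jet.tail]

theorem trd : HasJet (fun t => t.2.2) ⟨0, 0, 0, 1, 0⟩ :=
  of_eq fun t => by simp [Jet.eval, Jet.tail]

end HasJet

/-! ### Signs of expansions near the origin. -/

namespace Jet

/-- A criterion for a function with jet `j` to be negative near the origin of `driftRegion`. -/
def Negative (j : Jet) : Prop :=
  j.c < 0 ∨ (j.c = 0 ∧ j.v < 0 ∧ 10 * j.v + 17 * j.w < 0 ∧
    (j.u < 0 ∨ (j.u = 0 ∧ j.s < 0 ∧ 7 * j.s + 2 * j.w < 0)))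

instance : DecidablePred Negative := fun j => by unfold Negative; infer_instance

end Jet

theorem driftScale_le {t : ℝ × ℝ × ℝ} (ht : t ∈ driftRegion) :
    driftScale t ≤ 3 * (t.2.1 + t.1 ^ 2) := by
  obtain ⟨-, hq, hr, h⟩ := ht
  unfold driftScale
  nlinarith [sq_nonneg t.1]

/-- On `driftRegion`, a linear form in `q, r` is at most its maximum over the extreme rays. -/
theorem Jet.linear_le (v w : ℤ) (hv : v < 0) (hvw : 10 * v + 17 * w < 0) {t : ℝ × ℝ × ℝ}
    (ht : t ∈ driftRegion) :
    v * t.2.1 + w * t.2.2 ≤ -(1 / 10) * t.2.1 + max 0 ((w : ℝ) * (2 / 7)) * t.1 ^ 2 := by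
  obtain ⟨-, hq, hr, h⟩ := ht
  have hv' : (v : ℝ) ≤ -1 := by exact_mod_cast Int.le_sub_one_of_lt hv
  -- Integrality makes the strict inequality a gap of 1, whence the constant 1/10 after division by
  -- 10.
  have hvw' : (10 * v + 17 * w : ℝ) ≤ -1 := by exact_mod_cast Int.le_sub_one_of_lt hvw
  have hp := sq_nonneg t.1
  rcases le_total (w : ℝ) 0 with hw | hw
  · rw [max_eq_left (by linarith)]
    nlinarith [mul_nonneg_of_nonpos_of_nonpos hw (neg_nonpos.2 hr)]
  · rw [max_eq_right (by linarith)]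
    nlinarith

/-- If the constant term is zero, the conditions on `v`, `w`, `s` test the extreme rays of the cone
`r ≤ 17/10 * q + 2/7 * p ^ 2` in the coordinates `q, r, p ^ 2`. A negative `u` makes the last two
rays irrelevant, since `p` dominates `p ^ 2`. -/
theorem HasJet.eventually_neg {F : ℝ × ℝ × ℝ → ℝ} {j : Jet} (hF : HasJet F j)
    (hj : j.Negative) : ∀ᶠ t in 𝓝[driftRegion] 0, 0 < driftScale t → F t < 0 := by
  rcases hj with hc | ⟨hc, hv, hvw, hus⟩
  · filter_upwards [hF.tendsto.eventually_lt_const (by exact_mod_cast hc : (j.c : ℝ) < 0)]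
      with t ht _ using ht
  -- The bound `-(1/10) * (q + p ^ 2)` loses a factor 3 by `driftScale_le`; half of the resulting
  -- 1/30 absorbs the error.
  · have key : ∀ᶠ t in 𝓝[driftRegion] 0, j.eval t ≤ -(1 / 30) * driftScale t := by
      have hfst : Tendsto (fun t : ℝ × ℝ × ℝ => t.1) (𝓝[driftRegion] 0) (𝓝 0) :=
        tendsto_nhdsWithin_driftRegion continuous_fst
      set m : ℝ := max 0 ((j.w : ℝ) * (2 / 7)) with hm
      have hsmall : ∀ᶠ t in 𝓝[driftRegion] 0, (j.s + m + 1 / 10 : ℝ) * t.1 < 1 := by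
        have := hfst.const_mul (j.s + m + 1 / 10 : ℝ)
        rw [mul_zero] at this
        exact this.eventually_lt_const one_pos
      filter_upwards [eventually_mem_driftRegion, hsmall] with t ht hs
      have h1 := Jet.linear_le j.v j.w hv hvw ht
      have h2 := driftScale_le ht
      have hp := ht.1
      have h3 : (j.u : ℝ) * t.1 + j.s * t.1 ^ 2 + m * t.1 ^ 2 ≤ -(1 / 10) * t.1 ^ 2 := by
        rcases hus with hu | ⟨hu, hs1, hs2⟩
        · have hu' : (j.u : ℝ) ≤ -1 := by exact_mod_cast Int.le_sub_one_of_lt hu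
          nlinarith
        · have hs1' : (j.s : ℝ) ≤ -1 := by exact_mod_cast Int.le_sub_one_of_lt hs1
          have hs2' : (7 * j.s + 2 * j.w : ℝ) ≤ -1 := by
            exact_mod_cast Int.le_sub_one_of_lt hs2
          have hms : (j.s : ℝ) + m ≤ -(1 / 10) := by
            rcases le_total ((j.w : ℝ) * (2 / 7)) 0 with hw | hw
            · rw [hm, max_eq_left hw]; linarith
            · rw [hm, max_eq_right hw]; linarith
          rw [hu]
          push_cast
          nlinarith [sq_nonneg t.1]
      simp only [Jet.eval, Jet.tail, hc]
      push_cast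
      linarith
    filter_upwards [key, IsLittleO.def hF (by norm_num : (0 : ℝ) < 1 / 60),
      eventually_mem_driftRegion] with t h1 h2 ht hpos
    rw [Real.norm_of_nonneg hpos.le] at h2
    have := (abs_le.1 ((Real.norm_eq_abs _).symm.le.trans h2)).2
    linarith

/-! ### Potential, corrector and drift, over a general `R` to serve both real numbers and jets. -/

section Potential

variable {R : Type} [Add R] [Sub R] [Mul R]

/-- The indicator of `a = b`, cast to `R` by `κ`. -/
def letterIndicator (κ : ℤ → R) (a b : GameState) : R := κ (if a = b then 1 else 0)

/-- The potential, as a function of the weights `x, y, z` which a three-letter word (or its law)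
gives to the letters in its three positions. -/
def potential (κ : ℤ → R) (p q r : R) (x y z : GameState → R) : R :=
  (κ 10 + q + κ 29 * r + p * p) * x .D + (κ 20 + κ 2 * (p * p)) * (x .D * y .W)
    - κ 10 * (x .D * y .W * z .D) + (κ 20 * p - κ 10) * (x .D * y .W * z .W)

/-- The function of three consecutive letters whose discrete gradient corrects the drift. -/
def corrector (κ : ℤ → R) (p q r : R) (x y z : GameState → R) : R :=
  (κ 10 - q - κ 10 * r - κ 11 * (p * p)) * (x .D * y .D) - κ 10 * x .D - κ 10 * (y .D * z .W)
    + κ 10 * p * (x .W * y .W * z .D) - κ 5 * r * (x .D * y .D * z .W)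
    - (q + κ 15 * r + κ 14 * (p * p)) * (x .D * y .W) + r * (x .D * z .W)
    - κ 9 * (p * p) * (x .W * y .D)

/-- The expected increment of the potential in one step of the automaton with update matrix `φ`
started from a configuration that reads `a, b, c, d`, plus the gradient of the corrector. -/
def drift (κ : ℤ → R) (p q r : R) (φ : GameState → GameState → GameState → R)
    (a b c d : GameState) : R :=
  let δ := letterIndicator κ
  potential κ p q r (φ a b) (φ b c) (φ c d) - potential κ p q r (δ a) (δ b) (δ c)
    + (corrector κ p q r (δ b) (δ c) (δ d) - corrector κ p q r (δ a) (δ b) (δ c))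

/-- The drift, symmetrized under reversal of the word. -/
def symmDrift (κ : ℤ → R) (p q r : R) (φ : GameState → GameState → GameState → R)
    (a b c d : GameState) : R :=
  drift κ p q r φ a b c d + drift κ p q r φ d c b a

end Potential

/-- The jets of the entries of the update matrix. -/
def envelopeJet : GameState → GameState → GameState → Jet
  | .W, .W, .W => ⟨0, 1, 0, 0, 0⟩
  | .W, .W, .D => ⟨0, 0, 0, 0, 0⟩
  | .W, .W, .L => ⟨1, -1, 0, 0, 0⟩
  | .W, .L, .W | .L, .W, .W => ⟨1, 0, -1, -1, 0⟩
  | .W, .L, .D | .L, .W, .D => ⟨0, 0, 0, 0, 0⟩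
  | .W, .L, .L | .L, .W, .L => ⟨0, 0, 1, 1, 0⟩
  | .L, .L, .W => ⟨1, 0, -1, 0, 0⟩
  | .L, .L, .D => ⟨0, 0, 0, 0, 0⟩
  | .L, .L, .L => ⟨0, 0, 1, 0, 0⟩
  | .W, .D, .W | .D, .W, .W => ⟨0, 1, 0, 0, 0⟩
  | .W, .D, .D | .D, .W, .D => ⟨1, -1, -1, -1, 0⟩
  | .W, .D, .L | .D, .W, .L => ⟨0, 0, 1, 1, 0⟩
  | .L, .D, .W | .D, .L, .W => ⟨1, 0, -1, -1, 0⟩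
  | .L, .D, .D | .D, .L, .D => ⟨0, 0, 0, 1, 0⟩
  | .L, .D, .L | .D, .L, .L => ⟨0, 0, 1, 0, 0⟩
  | .D, .D, .W => ⟨0, 1, 0, 0, 0⟩
  | .D, .D, .D => ⟨1, -1, -1, 0, 0⟩
  | .D, .D, .L => ⟨0, 0, 1, 0, 0⟩

theorem hasJet_envelopeMatrix (a b c : GameState) :
    HasJet (fun t => envelopeMatrix t.1 t.2.1 t.2.2 a b c) (envelopeJet a b c) := by
  have h0 : HasJet (fun _ => (0 : ℝ)) (Jet.const 0) := by simpa using HasJet.const 0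
  have h1 : HasJet (fun _ => (1 : ℝ)) (Jet.const 1) := by simpa using HasJet.const 1
  have hp := HasJet.fst
  have hq := HasJet.snd
  have hr := HasJet.trd
  have ho := (h1.sub hp).sub hq
  have hr2 : HasJet (fun t => t.2.2 ^ 2) (⟨0, 0, 0, 1, 0⟩ * ⟨0, 0, 0, 1, 0⟩) := by
    simpa only [sq] using hr.mul hr
  have of_jet_eq : ∀ {F : ℝ × ℝ × ℝ → ℝ} {j k : Jet}, HasJet F j → j = k → HasJet F k :=
    fun hF e => e ▸ hF
  -- The algebraic form of each entry determines a jet `j`; truncated arithmetic then evaluates it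
  -- to the tabulated one.
  cases a <;> cases b <;> cases c <;> simp only [envelopeMatrix] <;> refine of_jet_eq (j := ?_) ?_ ?_
  any_goals with_reducible first
    | exact hp
    | exact h0
    | exact h1.sub hp
    | exact hp.add (ho.mul (h1.sub hr))
    | exact hq.add (ho.mul hr)
    | exact (ho.mul hr).add hq
    | exact hp.add (ho.mul (h1.sub hr2))
    | exact hq.add (ho.mul hr2)
    | exact ho.mul (h1.sub hr)
    | exact (ho.mul hr).mul (h1.sub hr)
    | exact ho.mul (h1.sub hr2)
  all_goals rfl

/-- The jet of `symmDrift`. -/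
def symmDriftJet : GameState → GameState → GameState → GameState → Jet :=
  symmDrift Jet.const ⟨0, 1, 0, 0, 0⟩ ⟨0, 0, 1, 0, 0⟩ ⟨0, 0, 0, 1, 0⟩ envelopeJet

/-- The drift is a polynomial expression in the parameters and matrix entries, so evaluating the
same expression in `Jet` gives its jet. -/
theorem hasJet_drift (a b c d : GameState) :
    HasJet (fun t => drift (fun n : ℤ => (n : ℝ)) t.1 t.2.1 t.2.2
        (envelopeMatrix t.1 t.2.1 t.2.2) a b c d)
      (drift Jet.const ⟨0, 1, 0, 0, 0⟩ ⟨0, 0, 1, 0, 0⟩ ⟨0, 0, 0, 1, 0⟩ envelopeJet a b c d) := by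
  simp only [drift, potential, corrector, letterIndicator]
  repeat' first
    | with_reducible exact hasJet_envelopeMatrix _ _ _
    | with_reducible exact HasJet.const _
    | with_reducible exact HasJet.fst
    | with_reducible exact HasJet.snd
    | with_reducible exact HasJet.trd
    | with_reducible apply HasJet.add
    | with_reducible apply HasJet.sub
    | with_reducible apply HasJet.mul

theorem hasJet_symmDrift (a b c d : GameState) :
    HasJet (fun t => symmDrift (fun n : ℤ => (n : ℝ)) t.1 t.2.1 t.2.2
        (envelopeMatrix t.1 t.2.1 t.2.2) a b c d) (symmDriftJet a b c d) :=
  (hasJet_drift a b c d).add (hasJet_drift d c b a)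

theorem symmDriftJet_negative : ∀ a b c d : GameState,
    (a = .D ∨ b = .D ∨ c = .D ∨ d = .D) → (symmDriftJet a b c d).Negative := by
  decide

/-- Each monomial of the potential and the corrector has a D factor, and two neighbours other than D
produce D with probability zero. -/
theorem symmDrift_eq_zero {p q r : ℝ} {a b c d : GameState}
    (ha : a ≠ .D) (hb : b ≠ .D) (hc : c ≠ .D) (hd : d ≠ .D) :
    symmDrift (fun n : ℤ => (n : ℝ)) p q r (envelopeMatrix p q r) a b c d = 0 := by
  cases a <;> cases b <;> cases c <;> cases d <;>
    simp_all [symmDrift, drift, potential, corrector, letterIndicator, envelopeMatrix]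

theorem exists_symmDrift_neg : ∃ ε > 0, ∀ p q r : ℝ, (p, q, r) ∈ driftRegion →
    p < ε → q < ε → r < ε → 0 < p + q + r → ∀ a b c d : GameState,
      (a = .D ∨ b = .D ∨ c = .D ∨ d = .D) →
      symmDrift (fun n : ℤ => (n : ℝ)) p q r (envelopeMatrix p q r) a b c d < 0 := by
  have h : ∀ᶠ t in 𝓝[driftRegion] 0, ∀ a b c d : GameState,
      (a = .D ∨ b = .D ∨ c = .D ∨ d = .D) → 0 < driftScale t →
      symmDrift (fun n : ℤ => (n : ℝ)) t.1 t.2.1 t.2.2 (envelopeMatrix t.1 t.2.1 t.2.2)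
        a b c d < 0 := by
    simp only [eventually_all]
    exact fun a b c d hD =>
      (hasJet_symmDrift a b c d).eventually_neg (symmDriftJet_negative a b c d hD)
  obtain ⟨ε, hε, hsub⟩ := Metric.mem_nhdsWithin_iff.1 h
  refine ⟨ε, hε, fun p q r ht hp hq hr hpos a b c d hD => ?_⟩
  have hmem : ((p, q, r) : ℝ × ℝ × ℝ) ∈ Metric.ball 0 ε := by
    simpa [Prod.norm_def, abs_of_nonneg ht.1, abs_of_nonneg ht.2.1, abs_of_nonneg ht.2.2.1]
      using ⟨hp, hq, hr⟩
  refine hsub ⟨hmem, ht⟩ a b c d hD ?_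
  obtain ⟨hp0, hq0, hr0, hle⟩ := ht
  simp only at hp0 hq0 hr0 hle
  simp only [driftScale]
  -- `driftScale` could vanish only at the origin, which `hpos` excludes.
  rcases hp0.eq_or_lt with h0 | h0
  · nlinarith
  · positivity

/-! ### From the parameter regime to the drift region. -/

theorem mem_driftRegion {p q r : ℝ} (hΘ : (p, q, r) ∈ paramSpace) (hp : p ≤ 1 / 1000)
    (hq : q ≤ 1 / 1000) (hr : r ≤ 1 / 1000) (hU : UniversalCondition p q r)
    {i : Fin 4} (hi : RegimeCondition p q r i) : (p, q, r) ∈ driftRegion := by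
  obtain ⟨⟨hp0, -⟩, ⟨hq0, -⟩, ⟨hr0, -⟩, -, -⟩ := hΘ
  simp only at hp0 hq0 hr0
  refine ⟨hp0, hq0, hr0, ?_⟩
  simp only
  simp only [UniversalCondition] at hU
  have hpq := mul_nonneg hp0 hq0
  have hpr := mul_nonneg hp0 hr0
  have hqr := mul_nonneg hq0 hr0
  have hpp := mul_nonneg hp0 hp0
  have hqq := mul_nonneg hq0 hq0
  have hrr := mul_nonneg hr0 hr0
  have hpp' : p * p ≤ 1 / 1000 * p := mul_le_mul_of_nonneg_right hp hp0
  have hqq' : q * q ≤ 1 / 1000 * q := mul_le_mul_of_nonneg_right hq hq0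
  have hrr' : r * r ≤ 1 / 1000 * r := mul_le_mul_of_nonneg_right hr hr0
  have hpr' : p * r ≤ 1 / 1000 * r := mul_le_mul_of_nonneg_right hp hr0
  have hqr' : q * r ≤ 1 / 1000 * r := mul_le_mul_of_nonneg_right hq hr0
  have hpq' : p * q ≤ 1 / 1000 * q := mul_le_mul_of_nonneg_right hp hq0
  have ho : 0 ≤ 1 - p - q := by linarith
  have hrle : r * (1 - p - q) ≤ r := by nlinarith
  fin_cases i
  -- To leading order `p ≤ q` and `4r ≤ 2(p + q)`, so `r ≤ q`.
  · simp only [RegimeCondition] at hi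
    have : q * (1 - q - r * (1 - p - q)) ≤ q := by nlinarith [mul_nonneg hr0 ho]
    nlinarith
  -- To leading order `p ≤ 2q` and `4r ≤ 2(p + q)`, so `r ≤ 3q/2`.
  · obtain ⟨-, -, h⟩ := hi
    nlinarith
  -- To leading order `p ≤ q + r` and `4r ≤ p + 4q`, so `r ≤ 5q/3`, the case that dictates a slope
  -- above 5/3.
  · obtain ⟨-, h1, -, h3⟩ := hi
    have hs : 0 ≤ q + r * (1 - p - q) := by positivity
    have : (q + r * (1 - p - q)) * (1 - q - r * (1 - p - q)) ≤ q + r := by nlinarith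
    nlinarith
  -- Here `q` may be negligible against `p`: to leading order `4r ≤ 6q + p ^ 2`, and 2/7 leaves room
  -- above 1/4.
  · obtain ⟨-, h⟩ := hi
    nlinarith

/-! ### Symmetries of integrals of local functions. -/

section Window

variable {μ : Measure Config}

theorem measurable_window (F : GameState → GameState → GameState → GameState → ℝ) (n : ℤ) :
    Measurable fun η : Config => F (η n) (η (n + 1)) (η (n + 2)) (η (n + 3)) := by
  have h : Measurable fun w : GameState × GameState × GameState × GameState =>
    F w.1 w.2.1 w.2.2.1 w.2.2.2 := measurable_of_countable _
  exact h.comp (f := fun η : Config => (η n, η (n + 1), η (n + 2), η (n + 3))) (by fun_prop)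

/-- A function of finitely many letters is integrable. -/
theorem integrable_window [IsFiniteMeasure μ]
    (F : GameState → GameState → GameState → GameState → ℝ) (n : ℤ) :
    Integrable (fun η : Config => F (η n) (η (n + 1)) (η (n + 2)) (η (n + 3))) μ := by
  have hπ : Measurable fun η : Config => (η n, η (n + 1), η (n + 2), η (n + 3)) := by fun_prop
  exact (Integrable.of_finite (μ := μ.map fun η : Config =>
    (η n, η (n + 1), η (n + 2), η (n + 3)))
    (f := fun w => F w.1 w.2.1 w.2.2.1 w.2.2.2)).comp_measurable hπ

theorem Config.measurable_shift (y : ℤ) : Measurable (Config.shift y) :=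
  measurable_pi_lambda _ fun x => measurable_pi_apply (x + y)

theorem Config.measurable_reflect : Measurable Config.reflect :=
  measurable_pi_lambda _ fun x => measurable_pi_apply (-x)

theorem TranslationInvariant.measurePreserving (hμ : TranslationInvariant μ) (y : ℤ) :
    MeasurePreserving (Config.shift y) μ μ := by
  refine ⟨Config.measurable_shift y, Measure.ext fun B hB => ?_⟩
  -- The preimage under a shift is the image under the inverse shift.
  rw [Measure.map_apply (Config.measurable_shift y) hB, ← hμ (-y) B hB]
  congr 1
  ext η
  refine ⟨fun h => ⟨_, h, ?_⟩, ?_⟩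
  · funext x
    simp [Config.shift]
  · rintro ⟨ξ, hξ, rfl⟩
    have : Config.shift y (Config.shift (-y) ξ) = ξ := funext fun x => by simp [Config.shift]
    rwa [Set.mem_preimage, this]

theorem ReflectionInvariant.measurePreserving (hμ : ReflectionInvariant μ) :
    MeasurePreserving Config.reflect μ μ := by
  refine ⟨Config.measurable_reflect, Measure.ext fun B hB => ?_⟩
  rw [Measure.map_apply Config.measurable_reflect hB, ← hμ B hB]
  congr 1
  ext η
  refine ⟨fun h => ⟨_, h, ?_⟩, ?_⟩
  · funext x
    simp [Config.reflect]
  · rintro ⟨ξ, hξ, rfl⟩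
    have : Config.reflect (Config.reflect ξ) = ξ := funext fun x => by simp [Config.reflect]
    rwa [Set.mem_preimage, this]

theorem TranslationInvariant.integral_window (hμ : TranslationInvariant μ)
    (F : GameState → GameState → GameState → GameState → ℝ) (n : ℤ) :
    ∫ η, F (η n) (η (n + 1)) (η (n + 2)) (η (n + 3)) ∂μ =
      ∫ η, F (η 0) (η 1) (η 2) (η 3) ∂μ := by
  have hn := hμ.measurePreserving n
  have h0 := measurable_window F 0
  simp only [zero_add] at h0
  rw [← hn.map_eq, integral_map hn.measurable.aemeasurable h0.aestronglyMeasurable, hn.map_eq]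
  simp [Config.shift, add_comm]

theorem ReflectionInvariant.integral_window_reverse (hμ : ReflectionInvariant μ)
    (hτ : TranslationInvariant μ) (F : GameState → GameState → GameState → GameState → ℝ) :
    ∫ η, F (η 3) (η 2) (η 1) (η 0) ∂μ = ∫ η, F (η 0) (η 1) (η 2) (η 3) ∂μ := by
  have hm := hμ.measurePreserving
  have h0 := measurable_window (fun a b c d => F d c b a) 0
  simp only [zero_add] at h0
  -- Reflection moves the window to positions -3, …, 0; translation brings it back.
  rw [← hm.map_eq, integral_map hm.measurable.aemeasurable h0.aestronglyMeasurable, hm.map_eq,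
    ← hτ.integral_window F (-3)]
  simp [Config.reflect]

end Window

/-! ### Consequences of stationarity. -/

section Stationary

variable {μ : Measure Config} {p q r : ℝ}

theorem envelopeRule_toMeasure_singleton (h : (p, q, r) ∈ paramSpace) (a b c : GameState) :
    (envelopeRule h a b).toMeasure {c} = ENNReal.ofReal (envelopeMatrix p q r a b c) := by
  rw [PMF.toMeasure_apply_singleton _ _ (measurableSet_singleton c)]
  rfl

theorem envelopePCA_apply_cylinder (h : (p, q, r) ∈ paramSpace) (η : Config) (s : Finset ℤ)
    (w : Config) :
    envelopePCA h η {ξ | ∀ i ∈ s, ξ i = w i} =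
      ENNReal.ofReal (∏ i ∈ s, envelopeMatrix p q r (η i) (η (i + 1)) (w i)) := by
  have hs : {ξ : Config | ∀ i ∈ s, ξ i = w i} = Set.pi s fun i => {w i} := by
    ext ξ; simp [Set.mem_pi]
  rw [hs]
  change pcaUpdateLaw (envelopeRule h) η _ = _
  rw [pcaUpdateLaw, Measure.infinitePi_pi _ fun i _ => measurableSet_singleton _,
    ENNReal.ofReal_prod_of_nonneg fun i _ => envelopeMatrix_nonneg h _ _ _]
  exact Finset.prod_congr rfl fun i _ => envelopeRule_toMeasure_singleton h _ _ _

theorem measurableSet_cylinder (s : Finset ℤ) (w : Config) :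
    MeasurableSet {ξ : Config | ∀ i ∈ s, ξ i = w i} := by
  simp only [Set.ofPred_forall]
  exact s.measurableSet_biInter fun i _ =>
    measurableSet_eq_fun (measurable_pi_apply i) measurable_const

theorem measurable_prod_envelopeMatrix (s : Finset ℤ) (w : Config) :
    Measurable fun η : Config => ∏ i ∈ s, envelopeMatrix p q r (η i) (η (i + 1)) (w i) := by
  refine Finset.measurable_prod _ fun i _ => ?_
  have h : Measurable fun a : GameState × GameState => envelopeMatrix p q r a.1 a.2 (w i) :=
    measurable_of_countable _
  exact h.comp (f := fun η : Config => (η i, η (i + 1))) (by fun_prop)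

/-- Stationarity, tested on a cylinder set. -/
theorem integral_prod_envelopeMatrix (h : (p, q, r) ∈ paramSpace) [IsProbabilityMeasure μ]
    (hμ : (envelopePCA h).Invariant μ) (s : Finset ℤ) (w : Config) :
    ∫ η, ∏ i ∈ s, envelopeMatrix p q r (η i) (η (i + 1)) (w i) ∂μ =
      ∫ η, ∏ i ∈ s, letterIndicator (fun n : ℤ => (n : ℝ)) (η i) (w i) ∂μ := by
  have hC := measurableSet_cylinder s w
  have hind : (fun η : Config => ∏ i ∈ s, letterIndicator (fun n : ℤ => (n : ℝ)) (η i) (w i)) =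
      {ξ : Config | ∀ i ∈ s, ξ i = w i}.indicator 1 := by
    funext η
    simp only [letterIndicator, Int.cast_ite, Int.cast_one, Int.cast_zero, Finset.prod_ite_zero,
      Finset.prod_const_one, Set.indicator, Set.mem_ofPred_eq, Pi.one_apply]
  rw [hind, integral_indicator_one hC, measureReal_def]
  conv_rhs => rw [← hμ.def, Measure.bind_apply hC (envelopePCA h).aemeasurable]
  simp_rw [envelopePCA_apply_cylinder]
  refine integral_eq_lintegral_of_nonneg_ae (.of_forall fun η => ?_)
    (measurable_prod_envelopeMatrix s w).aestronglyMeasurable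
  exact Finset.prod_nonneg fun i _ => envelopeMatrix_nonneg h _ _ _

/-- Stationarity, tested on the first one, two or three letters. -/
theorem integral_envelopeMatrix_words (h : (p, q, r) ∈ paramSpace) [IsProbabilityMeasure μ]
    (hμ : (envelopePCA h).Invariant μ) (a b c : GameState) :
    let φ := envelopeMatrix p q r
    let δ := letterIndicator fun n : ℤ => (n : ℝ)
    ∫ η, φ (η 0) (η 1) a ∂μ = ∫ η, δ (η 0) a ∂μ ∧
    ∫ η, φ (η 0) (η 1) a * φ (η 1) (η 2) b ∂μ = ∫ η, δ (η 0) a * δ (η 1) b ∂μ ∧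
    ∫ η, φ (η 0) (η 1) a * φ (η 1) (η 2) b * φ (η 2) (η 3) c ∂μ =
      ∫ η, δ (η 0) a * δ (η 1) b * δ (η 2) c ∂μ := by
  intro φ δ
  -- Only the values at 0, 1, 2 are used.
  let w : Config := fun i => if i = 0 then a else if i = 1 then b else c
  have h1 := integral_prod_envelopeMatrix h hμ {0} w
  have h2 := integral_prod_envelopeMatrix h hμ {0, 1} w
  have h3 := integral_prod_envelopeMatrix h hμ {0, 1, 2} w
  simp [w] at h1 h2 h3
  refine ⟨h1, h2, ?_⟩
  simpa only [mul_assoc] using h3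

/-- The potential is a combination of products with at most one factor per position. As cells update
independently, inserting the rows of the matrix gives its conditional expectation after one step,
which stationarity handles word by word. The corrector terms cancel by translation. -/
theorem integral_drift_eq_zero (h : (p, q, r) ∈ paramSpace) [IsProbabilityMeasure μ]
    (hτ : TranslationInvariant μ) (hμ : (envelopePCA h).Invariant μ) :
    ∫ η, drift (fun n : ℤ => (n : ℝ)) p q r (envelopeMatrix p q r) (η 0) (η 1) (η 2) (η 3) ∂μ
      = 0 := by
  have hint : ∀ F : GameState → GameState → GameState → GameState → ℝ,
      Integrable (fun η : Config => F (η 0) (η 1) (η 2) (η 3)) μ := fun F => by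
    simpa using integrable_window F 0
  set φ := envelopeMatrix p q r with hφ
  set δ := letterIndicator fun n : ℤ => (n : ℝ) with hδ
  set f := potential (fun n : ℤ => (n : ℝ)) p q r with hf
  set g := corrector (fun n : ℤ => (n : ℝ)) p q r with hg
  have hexp : ∫ η, f (φ (η 0) (η 1)) (φ (η 1) (η 2)) (φ (η 2) (η 3)) ∂μ =
      ∫ η, f (δ (η 0)) (δ (η 1)) (δ (η 2)) ∂μ := by
    have hlin : ∀ X Y Z : GameState → GameState → GameState → GameState → GameState → ℝ,
        ∫ η : Config, f (X (η 0) (η 1) (η 2) (η 3)) (Y (η 0) (η 1) (η 2) (η 3))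
          (Z (η 0) (η 1) (η 2) (η 3)) ∂μ =
        (10 + q + 29 * r + p * p) * ∫ η : Config, X (η 0) (η 1) (η 2) (η 3) .D ∂μ
        + (20 + 2 * (p * p)) * ∫ η : Config, X (η 0) (η 1) (η 2) (η 3) .D *
          Y (η 0) (η 1) (η 2) (η 3) .W ∂μ
        - 10 * ∫ η : Config, X (η 0) (η 1) (η 2) (η 3) .D * Y (η 0) (η 1) (η 2) (η 3) .W *
          Z (η 0) (η 1) (η 2) (η 3) .D ∂μ
        + (20 * p - 10) * ∫ η : Config, X (η 0) (η 1) (η 2) (η 3) .D *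
          Y (η 0) (η 1) (η 2) (η 3) .W * Z (η 0) (η 1) (η 2) (η 3) .W ∂μ := by
      intro X Y Z
      have i1 := hint fun a b c d => (10 + q + 29 * r + p * p) * X a b c d .D
      have i2 := hint fun a b c d => (20 + 2 * (p * p)) * (X a b c d .D * Y a b c d .W)
      have i3 := hint fun a b c d => 10 * (X a b c d .D * Y a b c d .W * Z a b c d .D)
      have i4 := hint fun a b c d => (20 * p - 10) * (X a b c d .D * Y a b c d .W * Z a b c d .W)
      have i12 := hint fun a b c d => (10 + q + 29 * r + p * p) * X a b c d .D
        + (20 + 2 * (p * p)) * (X a b c d .D * Y a b c d .W)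
      have i123 := hint fun a b c d => (10 + q + 29 * r + p * p) * X a b c d .D
        + (20 + 2 * (p * p)) * (X a b c d .D * Y a b c d .W)
        - 10 * (X a b c d .D * Y a b c d .W * Z a b c d .D)
      simp only [← integral_const_mul]
      rw [← integral_add i1 i2, ← integral_sub i12 i3, ← integral_add i123 i4]
      refine integral_congr_ae (.of_forall fun η => ?_)
      simp [hf, potential]
    obtain ⟨e1, e2, e3⟩ := integral_envelopeMatrix_words h hμ .D .W .D
    obtain ⟨-, -, e4⟩ := integral_envelopeMatrix_words h hμ .D .W .W
    rw [hlin (fun a b _ _ => φ a b) (fun _ b c _ => φ b c) (fun _ _ c d => φ c d),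
      hlin (fun a _ _ _ => δ a) (fun _ b _ _ => δ b) (fun _ _ c _ => δ c), e1, e2, e3, e4]
  have hcob : ∫ η, g (δ (η 1)) (δ (η 2)) (δ (η 3)) ∂μ =
      ∫ η, g (δ (η 0)) (δ (η 1)) (δ (η 2)) ∂μ := by
    simpa using hτ.integral_window (fun a b c _ => g (δ a) (δ b) (δ c)) 1
  have i1 := hint fun a b c d => f (φ a b) (φ b c) (φ c d)
  have i2 := hint fun a b c _ => f (δ a) (δ b) (δ c)
  have i3 := hint fun _ b c d => g (δ b) (δ c) (δ d)
  have i4 := hint fun a b c _ => g (δ a) (δ b) (δ c)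
  have i12 := hint fun a b c d => f (φ a b) (φ b c) (φ c d) - f (δ a) (δ b) (δ c)
  have i34 := hint fun a b c d => g (δ b) (δ c) (δ d) - g (δ a) (δ b) (δ c)
  simp only [drift, ← hδ, ← hf, ← hg]
  rw [integral_add i12 i34, integral_sub i1 i2, integral_sub i3 i4, hexp, hcob]
  ring

theorem integral_symmDrift_eq_zero (h : (p, q, r) ∈ paramSpace) [IsProbabilityMeasure μ]
    (hτ : TranslationInvariant μ) (hρ : ReflectionInvariant μ)
    (hμ : (envelopePCA h).Invariant μ) :
    ∫ η, symmDrift (fun n : ℤ => (n : ℝ)) p q r (envelopeMatrix p q r)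
      (η 0) (η 1) (η 2) (η 3) ∂μ = 0 := by
  have i1 := integrable_window (μ := μ)
    (drift (fun n : ℤ => (n : ℝ)) p q r (envelopeMatrix p q r)) 0
  have i2 := integrable_window (μ := μ) (fun a b c d =>
    drift (fun n : ℤ => (n : ℝ)) p q r (envelopeMatrix p q r) d c b a) 0
  simp only [zero_add] at i1 i2
  simp only [symmDrift]
  rw [integral_add i1 i2, hρ.integral_window_reverse hτ, integral_drift_eq_zero h hτ hμ, add_zero]

/-- A nonnegative function of integral zero vanishes almost everywhere, but `-F` is positive
wherever the first letter is D. -/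
theorem measure_draw_eq_zero (h : (p, q, r) ∈ paramSpace) [IsProbabilityMeasure μ]
    (hτ : TranslationInvariant μ) (hρ : ReflectionInvariant μ)
    (hμ : (envelopePCA h).Invariant μ)
    (hneg : ∀ a b c d : GameState, (a = .D ∨ b = .D ∨ c = .D ∨ d = .D) →
      symmDrift (fun n : ℤ => (n : ℝ)) p q r (envelopeMatrix p q r) a b c d < 0) (x : ℤ) :
    μ {η : Config | η x = GameState.D} = 0 := by
  set F := symmDrift (fun n : ℤ => (n : ℝ)) p q r (envelopeMatrix p q r)
  have hF : ∀ a b c d, 0 ≤ -F a b c d := fun a b c d => by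
    by_cases hD : a = .D ∨ b = .D ∨ c = .D ∨ d = .D
    · exact neg_nonneg.2 (hneg a b c d hD).le
    · push Not at hD
      exact (neg_eq_zero.2 (symmDrift_eq_zero hD.1 hD.2.1 hD.2.2.1 hD.2.2.2)).ge
  have hint := integrable_window (μ := μ) F 0
  simp only [zero_add] at hint
  have h0 : ∫ η : Config, -F (η 0) (η 1) (η 2) (η 3) ∂μ = 0 := by
    rw [integral_neg, integral_symmDrift_eq_zero h hτ hρ hμ, neg_zero]
  have hae := (integral_eq_zero_iff_of_nonneg (fun η => hF _ _ _ _) hint.neg).1 h0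
  have hzero : μ {η : Config | η 0 = GameState.D} = 0 := by
    refine measure_mono_null (fun η hη => ?_) (ae_iff.1 hae)
    exact (neg_pos.2 (hneg _ _ _ _ (Or.inl hη))).ne'
  have hD : MeasurableSet {η : Config | η 0 = GameState.D} :=
    measurableSet_eq_fun (measurable_pi_apply 0) measurable_const
  rw [← hzero, ← (hτ.measurePreserving x).measure_preimage hD.nullMeasurableSet]
  simp [Config.shift]

end Stationary

theorem theorem4 :
    ∃ ε₁ ∈ Set.Ioo (0 : ℝ) 1, ∃ ε₂ ∈ Set.Ioo (0 : ℝ) 1, ∃ ε₃ ∈ Set.Ioo (0 : ℝ) 1,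
      ∀ (p q r : ℝ) (hΘ : (p, q, r) ∈ paramSpace),
        p ≤ ε₁ → q ≤ ε₂ → r ≤ ε₃ →
        UniversalCondition p q r →
        (∃! i : Fin 4, RegimeCondition p q r i) →
        ∀ (μ : Measure Config) [IsProbabilityMeasure μ],
          TranslationInvariant μ → ReflectionInvariant μ →
          (envelopePCA hΘ).Invariant μ →
          ∀ x : ℤ, μ {η : Config | η x = GameState.D} = 0 := by
  obtain ⟨ε, hε, hneg⟩ := exists_symmDrift_neg
  -- The bound 1/1000 serves `mem_driftRegion`; halving `ε` turns `≤` into the required `<`.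
  have hmem : min (1 / 1000) (ε / 2) ∈ Set.Ioo (0 : ℝ) 1 :=
    ⟨lt_min (by norm_num) (half_pos hε), (min_le_left _ _).trans_lt (by norm_num)⟩
  refine ⟨_, hmem, _, hmem, _, hmem, fun p q r hΘ hp hq hr hU hR μ _ hτ hρ hμ => ?_⟩
  obtain ⟨i, hi, -⟩ := hR
  have hlt : min (1 / 1000) (ε / 2) < ε := (min_le_right _ _).trans_lt (half_lt_self hε)
  have hle := min_le_left (1 / 1000 : ℝ) (ε / 2)
  exact measure_draw_eq_zero hΘ hτ hρ hμ
    (hneg p q r (mem_driftRegion hΘ (hp.trans hle) (hq.trans hle) (hr.trans hle) hU hi)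
      (hp.trans_lt hlt) (hq.trans_lt hlt) (hr.trans_lt hlt) hΘ.2.2.2.1)
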